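/- Work in the untyped $\lambda$-calculus with $\beta$-convertibility $=_\beta$. Put $Y_0=\lambda f.\,\omega_f\omega_f$ with $\omega_f=\lambda x.\,f(xx)$; $\eta=\lambda x f.\,f(xxf)$; $\delta=\lambda a b.\,b(ab)$; and, for $n\ge 1$, $Y_n=\eta\,\eta\,\underbrace{\delta\cdots\delta}_{n-1}$ (application associating to the left). The sequence $Y_0,Y_1,Y_2,\dots$ is the Böhm sequence. The clocked $\lambda$-calculus extends $\lambda$-terms by a unary symbol $\tau$ and has the rules $(\lambda x.M)N\to\tau(M[x:=N])$ and $\tau(M)N\to\tau(MN)$, applied in arbitrary contexts. The clocked Lévy tree $\mathrm{LL}(M)$ of a term $M$ is its unique infinitary normal form, i.e. the unique finite or infinite normal form to which $M$ reduces by a finite or infinite, strongly convergent reduction. Let $=_\tau$ be the equivalence relation on finite and infinite terms generated by the rewriting rule $\tau(T)\to T$ applied in arbitrary contexts (so that $T=_\tau U$ means equality up to insertion and removal of finitely many symbols $\tau$). A redex $(\lambda x.M)N$ is *simple* if $x$ occurs at most once in $M$ or $N$ is a $\beta$-normal form. The set of *simple* terms is defined coinductively: $M$ is simple if it has no weak head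 normal form, or if its weak head reduction to weak head normal form contracts only simple redexes and ends in $\lambda x.M'$ with $M'$ simple or in $yM_1\cdots M_m$ with $m\ge 0$, $y$ a variable and $M_1,\dots,M_m$ simple. Then: 1. Every $Y_n$ ($n\ge 0$) is a fixed point combinator: it is closed and $Y_nF=_\beta F(Y_nF)$ for all terms $F$. 2. The $Y_n$ are pairwise inconvertible: $Y_m\neq_\beta Y_n$ whenever $m\ne n$. 3. For all $n\ge 0$ and every variable $x$, the terms $Y_n$ and $Y_nx$ are simple. 4. For every variable $x$, $\mathrm{LL}(Y_0x)=\tau(S)$, where $S$ is the infinite term with $S=\tau(x\,S)$. 5. For all $n\ge 1$ and every variable $x$, $\mathrm{LL}(Y_nx)=\tau^{2n}\bigl(x\,\mathrm{LL}(Y_nx)\bigr)$. 6. For all $m\neq n$ and every variable $x$, $\mathrm{LL}(Y_mx)\neq_\tau\mathrm{LL}(Y_nx)$; that is, the trees differ in infinitely many $\tau$'s. -/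

import Mathlib

namespace Clocked

/-! ## The lambda-calculus -/

/-- Finite lambda-terms modulo alpha-equivalence, with de Bruijn indices. -/
inductive Lam : Type
  | var : ℕ → Lam
  | lam : Lam → Lam
  | app : Lam → Lam → Lam

namespace Lam

/-- Lifting of a renaming under a binder. -/
def liftRen (r : ℕ → ℕ) : ℕ → ℕ
  | 0 => 0
  | k + 1 => r k + 1

def rename : (ℕ → ℕ) → Lam → Lam
  | r, var k => var (r k)
  | r, lam M => lam (rename (liftRen r) M)
  | r, app M N => app (rename r M) (rename r N)

/-- Lifting of a simultaneous substitution under a binder. -/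
def liftSub (s : ℕ → Lam) : ℕ → Lam
  | 0 => var 0
  | k + 1 => rename Nat.succ (s k)

/-- Capture-avoiding simultaneous substitution. -/
def subst : (ℕ → Lam) → Lam → Lam
  | s, var k => s k
  | s, lam M => lam (subst (liftSub s) M)
  | s, app M N => app (subst s M) (subst s N)

/-- The substitution that replaces the outermost bound variable by `N`. -/
def single (N : Lam) : ℕ → Lam
  | 0 => N
  | k + 1 => var k

/-- `inst M N` is `M[x := N]`, where `x` is the variable with index `0`. -/
def inst (M N : Lam) : Lam := subst (single N) M

/-- The number of free occurrences of the variable with index `k`. -/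
def occ : ℕ → Lam → ℕ
  | k, var j => if j = k then 1 else 0
  | k, lam M => occ (k + 1) M
  | k, app M N => occ k M + occ k N

def Closed (M : Lam) : Prop := ∀ k, occ k M = 0

/-- One-step beta-reduction, in arbitrary contexts. -/
inductive Beta : Lam → Lam → Prop
  | beta (M N : Lam) : Beta (app (lam M) N) (inst M N)
  | lam {M M' : Lam} : Beta M M' → Beta (lam M) (lam M')
  | appL {M M' : Lam} (N : Lam) : Beta M M' → Beta (app M N) (app M' N)
  | appR (M : Lam) {N N' : Lam} : Beta N N' → Beta (app M N) (app M N')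

/-- Beta-convertibility: the equivalence closure of one-step beta-reduction. -/
def Conv : Lam → Lam → Prop := Relation.EqvGen Beta

def IsNormal (M : Lam) : Prop := ∀ N, ¬ Beta M N

/-- A combinator `Y` with `Y F = F (Y F)` modulo beta, for all terms `F`. -/
def IsFixedPointCombinator (Y : Lam) : Prop :=
  Closed Y ∧ ∀ F : Lam, Conv (app Y F) (app F (app Y F))

/-! ### Simple terms -/

/-- `Neutral P M`: the term `M` is of the form `y M₁ … Mₘ` (`m ≥ 0`) with `y` a variable
and all of `M₁, …, Mₘ` satisfying `P`. -/
inductive Neutral (P : Lam → Prop) : Lam → Prop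
  | var (k : ℕ) : Neutral P (var k)
  | app {M N : Lam} : Neutral P M → P N → Neutral P (app M N)

/-- Weak head normal forms: `λx.M` or `y M₁ … Mₘ`. -/
def IsWhnf (M : Lam) : Prop := (∃ M', M = lam M') ∨ Neutral (fun _ => True) M

def HasWhnf (M : Lam) : Prop := ∃ N, Relation.ReflTransGen Beta M N ∧ IsWhnf N

/-- The redex `(λx.M) N` is linear (`x` occurs at most once in `M`)
or call-by-value (`N` is a normal form). -/
def SimpleRedex (M N : Lam) : Prop := occ 0 M ≤ 1 ∨ IsNormal N

/-- One step of weak head reduction in which the contracted redex is simple. (Weak head reduction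
is deterministic, so a sequence of such steps is *the* head reduction, contracting
only simple redexes.) -/
inductive SimpleHead : Lam → Lam → Prop
  | beta {M N : Lam} : SimpleRedex M N → SimpleHead (app (lam M) N) (inst M N)
  | appL {M M' : Lam} (N : Lam) : SimpleHead M M' → SimpleHead (app M N) (app M' N)

/-- One unfolding of the definition of simple terms, with `P` for the simplicity of the
immediate components. -/
def SimpleLayer (P : Lam → Prop) (M : Lam) : Prop :=
  ¬ HasWhnf M ∨
  (∃ M', Relation.ReflTransGen SimpleHead M (lam M') ∧ P M') ∨
  (∃ N, Relation.ReflTransGen SimpleHead M N ∧ Neutral P N)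

/-- Simple terms: the largest predicate `P` with `P M → SimpleLayer P M`. -/
def Simple (M : Lam) : Prop :=
  ∃ P : Lam → Prop, (∀ N, P N → SimpleLayer P N) ∧ P M

/-! ### The Boehm sequence -/

/-- `leftIter M N n = M N N … N` with `n` arguments `N`, associated to the left. -/
def leftIter : Lam → Lam → ℕ → Lam
  | M, _, 0 => M
  | M, N, n + 1 => leftIter (app M N) N n

/-- `ω_f = λx. f (x x)`, where `f` is the free variable with index `0`. -/
def omegaF : Lam := lam (app (var 1) (app (var 0) (var 0)))

/-- Curry's fixed point combinator `λf. ω_f ω_f`. -/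
def curryY : Lam := lam (app omegaF omegaF)

/-- `η = λx f. f (x x f)`. -/
def eta : Lam := lam (lam (app (var 0) (app (app (var 1) (var 1)) (var 0))))

/-- `δ = λa b. b (a b)`. -/
def delta : Lam := lam (lam (app (var 0) (app (var 1) (var 0))))

/-- The Boehm sequence: `Y₀` is Curry's fixed point combinator, `Yₙ = η η δ … δ`
with `n - 1` arguments `δ` for `n ≥ 1`. -/
def boehmY : ℕ → Lam
  | 0 => curryY
  | n + 1 => leftIter (app eta eta) delta n

end Lam

/-! ## The clocked lambda-calculus -/

/-- Finite terms of the clocked lambda-calculus. -/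
inductive Clk : Type
  | var : ℕ → Clk
  | lam : Clk → Clk
  | app : Clk → Clk → Clk
  | tau : Clk → Clk

namespace Clk

def rename : (ℕ → ℕ) → Clk → Clk
  | r, var k => var (r k)
  | r, lam M => lam (rename (Lam.liftRen r) M)
  | r, app M N => app (rename r M) (rename r N)
  | r, tau M => tau (rename r M)

def liftSub (s : ℕ → Clk) : ℕ → Clk
  | 0 => var 0
  | k + 1 => rename Nat.succ (s k)

def subst : (ℕ → Clk) → Clk → Clk
  | s, var k => s k
  | s, lam M => lam (subst (liftSub s) M)
  | s, app M N => app (subst s M) (subst s N)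
  | s, tau M => tau (subst s M)

def single (N : Clk) : ℕ → Clk
  | 0 => N
  | k + 1 => var k

def inst (M N : Clk) : Clk := subst (single N) M

/-- The inclusion of lambda-terms into the terms of the clocked lambda-calculus. -/
def ofLam : Lam → Clk
  | .var k => var k
  | .lam M => lam (ofLam M)
  | .app M N => app (ofLam M) (ofLam N)

/-- One-step reduction of the clocked lambda-calculus, in arbitrary contexts. -/
inductive Step : Clk → Clk → Prop
  | beta (M N : Clk) : Step (app (lam M) N) (tau (inst M N))
  | move (M N : Clk) : Step (app (tau M) N) (tau (app M N))
  | lam {M M' : Clk} : Step M M' → Step (lam M) (lam M')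
  | appL {M M' : Clk} (N : Clk) : Step M M' → Step (app M N) (app M' N)
  | appR (M : Clk) {N N' : Clk} : Step N N' → Step (app M N) (app M N')
  | tau {M M' : Clk} : Step M M' → Step (tau M) (tau M')

end Clk

/-! ### Finite and infinite clocked terms -/

inductive Node : Type
  | var : ℕ → Node
  | lam : Node
  | app : Node
  | tau : Node

def Node.arity : Node → ℕ
  | .var _ => 0
  | .lam => 1
  | .app => 2
  | .tau => 1

/-- The coinductive type of finite and infinite terms of the clocked lambda-calculus. -/
abbrev Tree : Type := PFunctor.M ⟨Node, fun a => Fin a.arity⟩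

namespace Tree

def var (k : ℕ) : Tree := PFunctor.M.mk ⟨Node.var k, Fin.elim0⟩
def lam (T : Tree) : Tree := PFunctor.M.mk ⟨Node.lam, fun _ => T⟩
def app (T U : Tree) : Tree := PFunctor.M.mk ⟨Node.app, ![T, U]⟩
def tau (T : Tree) : Tree := PFunctor.M.mk ⟨Node.tau, fun _ => T⟩

/-- `T` has a subterm that is a redex, that is, of the form `(λx.A) B` or `τ(A) B`. -/
inductive HasRedex : Tree → Prop
  | beta (A B : Tree) : HasRedex (app (lam A) B)
  | move (A B : Tree) : HasRedex (app (tau A) B)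
  | lam {T : Tree} : HasRedex T → HasRedex (lam T)
  | appL {T : Tree} (U : Tree) : HasRedex T → HasRedex (app T U)
  | appR (T : Tree) {U : Tree} : HasRedex U → HasRedex (app T U)
  | tau {T : Tree} : HasRedex T → HasRedex (tau T)

/-- Normal forms of the clocked lambda-calculus. -/
def IsNormal (T : Tree) : Prop := ¬ HasRedex T

/-- The rewrite relation `τ(T) → T`, in arbitrary contexts. -/
inductive TauStep : Tree → Tree → Prop
  | root (T : Tree) : TauStep (tau T) T
  | lam {T T' : Tree} : TauStep T T' → TauStep (lam T) (lam T')
  | appL {T T' : Tree} (U : Tree) : TauStep T T' → TauStep (app T U) (app T' U)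
  | appR (T : Tree) {U U' : Tree} : TauStep U U' → TauStep (app T U) (app T U')
  | tau {T T' : Tree} : TauStep T T' → TauStep (tau T) (tau T')

/-- The equivalence closure of `TauStep`: equality up to insertion and removal of finitely many
symbols `τ`. -/
def TauEq : Tree → Tree → Prop := Relation.EqvGen TauStep

end Tree

/-- `RootMatch R M T`: the term `M` and the tree `T` have the same root symbol, and their immediate
subterms are pairwise related by `R`. -/
inductive RootMatch (R : Clk → Tree → Prop) : Clk → Tree → Prop
  | var (k : ℕ) : RootMatch R (.var k) (.var k)
  | lam {M : Clk} {T : Tree} : R M T → RootMatch R (.lam M) (.lam T)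
  | app {M N : Clk} {T U : Tree} : R M T → R N U → RootMatch R (.app M N) (.app T U)
  | tau {M : Clk} {T : Tree} : R M T → RootMatch R (.tau M) (.tau T)

/-- Infinitary (strongly convergent) reduction of a finite clocked term to a possibly infinite one,
in the coinductive presentation: the largest relation `R` such that `R M T` implies that `M`
reduces in finitely many steps to a term with the same root symbol as `T` whose immediate subterms
are related by `R` to those of `T`. These are the reductions of length at most `ω`; by compression,
longer ones reach no further terms. -/
def InfRed (M : Clk) (T : Tree) : Prop :=
  ∃ R : Clk → Tree → Prop,
    (∀ N U, R N U → ∃ N', Relation.ReflTransGen Clk.Step N N' ∧ RootMatch R N' U) ∧ R M T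

/-- `T` is a clocked Levy tree of the lambda-term `M`: an infinitary normal form of `M` in the
clocked lambda-calculus. -/
def IsClockedLevyTree (M : Lam) (T : Tree) : Prop :=
  InfRed (Clk.ofLam M) T ∧ T.IsNormal

/-- `M` eventually matches `N`: their clocked Levy trees are equal up to insertion and removal of
finitely many symbols `τ`. -/
def EventuallyMatches (M N : Lam) : Prop :=
  ∃ T U, IsClockedLevyTree M T ∧ IsClockedLevyTree N U ∧ Tree.TauEq T U

end Clocked

/-! Inconvertibility is proved without trees. By the Church–Rosser theorem it suffices that `Yₘ` and
`Yₙ` have no common reduct. For `n ≥ 1` the reducts of `Yₙ` lie in a set `BoehmReduct n`, closed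
under beta: contraction may create heads `δ` and abstractions `λf. f(⋯f(M f))`, but the number of
trailing arguments `δ` around the core `η η` is preserved, and it can be read off the term. The
reducts of `Y₀` are exhausted by `λf. fᵏ(ω_f ω_f)`, which are of no such shape. Confluence of beta
comes from that of the clocked calculus by erasing `τ`.

The trees come from cyclic reductions. One step takes `η η` to `λf. f(η η f)`. If `Y` reduces to
`λf. f(Y f)`, then `Y δ → δ(Y δ) → λf. f(Y δ f)`, so each further `δ` costs exactly two
contractions. Supplying `x` costs one more, whence `Yₙ x` reduces to `τ²ⁿ(x (Yₙ x))`; moving a `τ`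
outwards creates none. Uniqueness of infinitary normal forms is a bisimulation argument from
confluence: joinable terms have normal trees with equal roots.

For the last claim, follow the rightmost branch of a tree. Finitely many insertions and removals of
`τ` only shift, from some point on, the positions of the applications. In `S = τᶜ(x S)` these
positions are periodic with exact period `c + 1`, so `c` is an invariant; its values are 1 for `Y₀`
and `2n` for `Yₙ`, all distinct. -/

namespace Clocked

open Relation

/-! ### Substitution in the clocked calculus -/

namespace Clk

theorem liftRen_comp (q r : ℕ → ℕ) :
    Lam.liftRen q ∘ Lam.liftRen r = Lam.liftRen (q ∘ r) := by
  funext k; cases k <;> rfl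

theorem rename_rename (M : Clk) (q r : ℕ → ℕ) :
    rename q (rename r M) = rename (q ∘ r) M := by
  induction M generalizing q r with
  | var k => rfl
  | lam M ih => simp [rename, ih, liftRen_comp]
  | app M N ihM ihN => simp [rename, ihM, ihN]
  | tau M ih => simp [rename, ih]

theorem liftSub_comp_liftRen (s : ℕ → Clk) (r : ℕ → ℕ) :
    liftSub s ∘ Lam.liftRen r = liftSub (s ∘ r) := by
  funext k; cases k <;> rfl

theorem subst_rename (M : Clk) (s : ℕ → Clk) (r : ℕ → ℕ) :
    subst s (rename r M) = subst (s ∘ r) M := by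
  induction M generalizing s r with
  | var k => rfl
  | lam M ih => simp [rename, subst, ih, liftSub_comp_liftRen]
  | app M N ihM ihN => simp [rename, subst, ihM, ihN]
  | tau M ih => simp [rename, subst, ih]

theorem rename_comp_liftSub (r : ℕ → ℕ) (s : ℕ → Clk) :
    rename (Lam.liftRen r) ∘ liftSub s = liftSub (rename r ∘ s) := by
  funext k
  cases k with
  | zero => rfl
  | succ k =>
    simp only [Function.comp_apply, liftSub, rename_rename]
    congr 1

theorem rename_subst (M : Clk) (r : ℕ → ℕ) (s : ℕ → Clk) :
    rename r (subst s M) = subst (rename r ∘ s) M := by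
  induction M generalizing r s with
  | var k => rfl
  | lam M ih => simp [rename, subst, ih, rename_comp_liftSub]
  | app M N ihM ihN => simp [rename, subst, ihM, ihN]
  | tau M ih => simp [rename, subst, ih]

theorem subst_comp_liftSub (s t : ℕ → Clk) :
    subst (liftSub s) ∘ liftSub t = liftSub (subst s ∘ t) := by
  funext k
  cases k with
  | zero => rfl
  | succ k =>
    simp only [Function.comp_apply, liftSub, subst_rename, rename_subst]
    congr 1

theorem subst_subst (M : Clk) (s t : ℕ → Clk) :
    subst s (subst t M) = subst (subst s ∘ t) M := by
  induction M generalizing s t with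
  | var k => rfl
  | lam M ih => simp [subst, ih, subst_comp_liftSub]
  | app M N ihM ihN => simp [subst, ihM, ihN]
  | tau M ih => simp [subst, ih]

theorem liftSub_var : liftSub var = var := by
  funext k; cases k <;> rfl

theorem subst_var (M : Clk) : subst var M = M := by
  induction M with
  | var k => rfl
  | lam M ih => simp [subst, liftSub_var, ih]
  | app M N ihM ihN => simp [subst, ihM, ihN]
  | tau M ih => simp [subst, ih]

@[simp]
theorem subst_single_rename_succ (M N : Clk) : subst (single N) (rename Nat.succ M) = M := by
  rw [subst_rename]
  exact subst_var M

theorem rename_inst (M N : Clk) (r : ℕ → ℕ) :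
    rename r (inst M N) = inst (rename (Lam.liftRen r) M) (rename r N) := by
  rw [inst, inst, rename_subst, subst_rename]
  congr 1
  funext k; cases k <;> rfl

theorem subst_inst (M N : Clk) (s : ℕ → Clk) :
    subst s (inst M N) = inst (subst (liftSub s) M) (subst s N) := by
  rw [inst, inst, subst_subst, subst_subst]
  congr 1
  funext k
  cases k with
  | zero => rfl
  | succ k => exact (subst_single_rename_succ _ _).symm

/-! ### Confluence -/

/-- Parallel reduction. -/
inductive Par : Clk → Clk → Prop
  | var (k : ℕ) : Par (var k) (var k)
  | lam {M M' : Clk} : Par M M' → Par (lam M) (lam M')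
  | app {M M' N N' : Clk} : Par M M' → Par N N' → Par (app M N) (app M' N')
  | tau {M M' : Clk} : Par M M' → Par (tau M) (tau M')
  | beta {M M' N N' : Clk} : Par M M' → Par N N' → Par (app (lam M) N) (tau (inst M' N'))
  | move {M M' N N' : Clk} : Par M M' → Par N N' → Par (app (tau M) N) (tau (app M' N'))

theorem Par.refl (M : Clk) : Par M M := by
  induction M with
  | var k => exact .var k
  | lam M ih => exact .lam ih
  | app M N ihM ihN => exact .app ihM ihN
  | tau M ih => exact .tau ih

theorem Par.rename {M N : Clk} (h : Par M N) (r : ℕ → ℕ) :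
    Par (M.rename r) (N.rename r) := by
  induction h generalizing r with
  | var k => exact .var _
  | lam _ ih => exact .lam (ih _)
  | app _ _ ihM ihN => exact .app (ihM _) (ihN _)
  | tau _ ih => exact .tau (ih _)
  | beta _ _ ihM ihN =>
    simp only [Clk.rename, rename_inst]
    exact .beta (ihM _) (ihN _)
  | move _ _ ihM ihN => exact .move (ihM _) (ihN _)

theorem Par.liftSub {s t : ℕ → Clk} (h : ∀ k, Par (s k) (t k)) (k : ℕ) :
    Par (Clk.liftSub s k) (Clk.liftSub t k) := by
  cases k with
  | zero => exact .var 0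
  | succ k => exact (h k).rename _

theorem Par.subst {M N : Clk} (h : Par M N) {s t : ℕ → Clk} (hst : ∀ k, Par (s k) (t k)) :
    Par (M.subst s) (N.subst t) := by
  induction h generalizing s t with
  | var k => exact hst k
  | lam _ ih => exact .lam (ih (Par.liftSub hst))
  | app _ _ ihM ihN => exact .app (ihM hst) (ihN hst)
  | tau _ ih => exact .tau (ih hst)
  | beta _ _ ihM ihN =>
    simp only [Clk.subst, subst_inst]
    exact .beta (ihM (Par.liftSub hst)) (ihN hst)
  | move _ _ ihM ihN => exact .move (ihM hst) (ihN hst)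

theorem Par.inst {M M' N N' : Clk} (hM : Par M M') (hN : Par N N') :
    Par (M.inst N) (M'.inst N') := by
  refine hM.subst fun k => ?_
  cases k with
  | zero => exact hN
  | succ k => exact .var k

/-- Complete development: contraction of all redexes of a term. -/
def develop : Clk → Clk
  | var k => var k
  | lam M => lam (develop M)
  | app (lam M) N => tau (inst (develop M) (develop N))
  | app (tau M) N => tau (app (develop M) (develop N))
  | app (var k) N => app (var k) (develop N)
  | app (app M M') N => app (develop (app M M')) (develop N)
  | tau M => tau (develop M)

/-- Takahashi's triangle property: every parallel reduct of `M` still reduces to the complete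
development of `M`, which depends on `M` alone. Hence parallel reduction has the diamond property.
-/
theorem Par.develop {M N : Clk} (h : Par M N) : Par N M.develop := by
  induction h with
  | var k => exact .var k
  | lam _ ih => exact .lam ih
  | @app M M' N N' hM hN ihM ihN =>
    cases M with
    | var k => cases hM; exact .app (.var k) ihN
    | lam M =>
      cases hM with
      | lam hM => cases ihM with | lam ihM => exact .beta ihM ihN
    | app M₁ M₂ => exact .app ihM ihN
    | tau M =>
      cases hM with
      | tau hM => cases ihM with | tau ihM => exact .move ihM ihN
  | tau _ ih => exact .tau ih
  | beta _ _ ihM ihN => exact .tau (ihM.inst ihN)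
  | move _ _ ihM ihN => exact .tau (.app ihM ihN)

theorem Step.par {M N : Clk} (h : Step M N) : Par M N := by
  induction h with
  | beta M N => exact .beta (.refl M) (.refl N)
  | move M N => exact .move (.refl M) (.refl N)
  | lam _ ih => exact .lam ih
  | appL N _ ih => exact .app ih (.refl N)
  | appR M _ ih => exact .app (.refl M) ih
  | tau _ ih => exact .tau ih

/-- Reduction in finitely many steps. -/
abbrev Red : Clk → Clk → Prop := ReflTransGen Step

theorem Red.lam {M M' : Clk} (h : Red M M') : Red (lam M) (lam M') :=
  h.lift Clk.lam fun _ _ => Step.lam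

theorem Red.tau {M M' : Clk} (h : Red M M') : Red (tau M) (tau M') :=
  h.lift Clk.tau fun _ _ => Step.tau

theorem Red.appL {M M' : Clk} (N : Clk) (h : Red M M') : Red (app M N) (app M' N) :=
  h.lift (fun M => Clk.app M N) fun _ _ => Step.appL N

theorem Red.appR (M : Clk) {N N' : Clk} (h : Red N N') : Red (app M N) (app M N') :=
  h.lift (Clk.app M) fun _ _ => Step.appR M

theorem Red.app {M M' N N' : Clk} (hM : Red M M') (hN : Red N N') :
    Red (app M N) (app M' N') :=
  (hM.appL N).trans (hN.appR M')

theorem Par.red {M N : Clk} (h : Par M N) : Red M N := by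
  induction h with
  | var k => exact .refl
  | lam _ ih => exact ih.lam
  | app _ _ ihM ihN => exact ihM.app ihN
  | tau _ ih => exact ih.tau
  | beta _ _ ihM ihN => exact (Red.app ihM.lam ihN).tail (.beta _ _)
  | move _ _ ihM ihN => exact (Red.app ihM.tau ihN).tail (.move _ _)

theorem red_eq_reflTransGen_par : Red = ReflTransGen Par := by
  funext M N
  refine propext ⟨fun h => ReflTransGen.mono (fun _ _ => Step.par) _ _ h, fun h => ?_⟩
  induction h with
  | refl => exact .refl
  | tail _ h ih => exact ih.trans h.red

theorem Red.confluent {M N P : Clk} (hN : Red M N) (hP : Red M P) : Join Red N P := by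
  rw [red_eq_reflTransGen_par] at *
  exact church_rosser
    (fun M _ _ h h' => ⟨M.develop, .single h.develop, .single h'.develop⟩) hN hP

theorem join_trans {M N P : Clk} (h : Join Red M N) (h' : Join Red N P) : Join Red M P := by
  obtain ⟨Q, hMQ, hNQ⟩ := h
  obtain ⟨Q', hNQ', hPQ'⟩ := h'
  obtain ⟨Z, hQZ, hQ'Z⟩ := hNQ.confluent hNQ'
  exact ⟨Z, hMQ.trans hQZ, hPQ'.trans hQ'Z⟩

theorem join_of_red {M M' N N' : Clk} (h : Join Red M N) (hM : Red M M') (hN : Red N N') :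
    Join Red M' N' :=
  join_trans (join_trans ⟨M', .refl, hM⟩ h) ⟨N', hN, .refl⟩

/-! ### Erasure of the symbols `τ` -/

/-- The lambda-term obtained by removal of all symbols `τ`. -/
def erase : Clk → Lam
  | var k => .var k
  | lam M => .lam (erase M)
  | app M N => .app (erase M) (erase N)
  | tau M => erase M

theorem erase_ofLam (M : Lam) : erase (ofLam M) = M := by
  induction M with
  | var k => rfl
  | lam M ih => simp [ofLam, erase, ih]
  | app M N ihM ihN => simp [ofLam, erase, ihM, ihN]

theorem erase_rename (M : Clk) (r : ℕ → ℕ) : erase (rename r M) = Lam.rename r (erase M) := by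
  induction M generalizing r with
  | var k => rfl
  | lam M ih => simp [erase, rename, Lam.rename, ih]
  | app M N ihM ihN => simp [erase, rename, Lam.rename, ihM, ihN]
  | tau M ih => simp [erase, rename, ih]

theorem erase_comp_liftSub (s : ℕ → Clk) : erase ∘ liftSub s = Lam.liftSub (erase ∘ s) := by
  funext k
  cases k with
  | zero => rfl
  | succ k => exact erase_rename _ _

theorem erase_subst (M : Clk) (s : ℕ → Clk) :
    erase (subst s M) = Lam.subst (erase ∘ s) (erase M) := by
  induction M generalizing s with
  | var k => rfl
  | lam M ih => simp [erase, subst, Lam.subst, ih, erase_comp_liftSub]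
  | app M N ihM ihN => simp [erase, subst, Lam.subst, ihM, ihN]
  | tau M ih => simp [erase, subst, ih]

theorem erase_inst (M N : Clk) : erase (inst M N) = Lam.inst (erase M) (erase N) := by
  rw [inst, Lam.inst, erase_subst]
  congr 1
  funext k; cases k <;> rfl

theorem Step.erase {M N : Clk} (h : Step M N) :
    ReflTransGen Lam.Beta (erase M) (erase N) := by
  induction h with
  | beta M N =>
    simp only [Clk.erase, erase_inst]
    exact .single (.beta _ _)
  | move M N => exact .refl
  | lam _ ih => exact ih.lift Lam.lam fun _ _ => Lam.Beta.lam
  | appL N _ ih => exact ih.lift (fun M => Lam.app M N.erase) fun _ _ => Lam.Beta.appL _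
  | appR M _ ih => exact ih.lift (Lam.app M.erase) fun _ _ => Lam.Beta.appR _
  | tau _ ih => exact ih

theorem Red.erase {M N : Clk} (h : Red M N) : ReflTransGen Lam.Beta (erase M) (erase N) := by
  induction h with
  | refl => exact .refl
  | tail _ h ih => exact ih.trans h.erase

/-- Symbols `τ` standing between the abstraction and its argument block the redex; `move` steps
bring them outside first, and erasure does not see these steps. -/
theorem exists_red_of_erase_eq_lam {C : Clk} {M : Lam} (h : erase C = .lam M) (N : Clk) :
    ∃ P, Red (app C N) P ∧ erase P = Lam.inst M (erase N) := by
  induction C with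
  | var k => cases h
  | lam C _ =>
    cases h
    exact ⟨_, .single (.beta _ _), erase_inst _ _⟩
  | app C D _ _ => cases h
  | tau C ih =>
    obtain ⟨P, hP, hPM⟩ := ih h
    exact ⟨tau P, hP.tau.head (.move _ _), hPM⟩

theorem exists_red_of_beta {M N : Lam} (h : Lam.Beta M N) {C : Clk} (hC : erase C = M) :
    ∃ D, Red C D ∧ erase D = N := by
  induction C generalizing M N with
  | var k => subst hC; cases h
  | lam C ih =>
    subst hC
    cases h with
    | lam h =>
      obtain ⟨D, hD, rfl⟩ := ih h rfl
      exact ⟨_, hD.lam, rfl⟩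
  | app C C' ih ih' =>
    simp only [erase] at hC
    cases h with
    | beta M N =>
      simp only [Lam.app.injEq] at hC
      obtain ⟨hC, rfl⟩ := hC
      exact exists_red_of_erase_eq_lam hC C'
    | lam _ => cases hC
    | appL N h =>
      simp only [Lam.app.injEq] at hC
      obtain ⟨hC, rfl⟩ := hC
      obtain ⟨D, hD, rfl⟩ := ih h hC
      exact ⟨_, hD.appL _, rfl⟩
    | appR M h =>
      simp only [Lam.app.injEq] at hC
      obtain ⟨rfl, hC⟩ := hC
      obtain ⟨D, hD, rfl⟩ := ih' h hC
      exact ⟨_, hD.appR _, rfl⟩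
  | tau C ih =>
    obtain ⟨D, hD, rfl⟩ := ih h hC
    exact ⟨_, hD.tau, rfl⟩

theorem exists_red_of_betas {M N : Lam} (h : ReflTransGen Lam.Beta M N) :
    ∃ D, Red (ofLam M) D ∧ erase D = N := by
  induction h with
  | refl => exact ⟨_, .refl, erase_ofLam M⟩
  | tail _ h ih =>
    obtain ⟨C, hC, hCN⟩ := ih
    obtain ⟨D, hD, hDN⟩ := exists_red_of_beta h hCN
    exact ⟨D, hC.trans hD, hDN⟩

end Clk

/-! ### Confluence of beta, transferred along erasure -/

namespace Lam

theorem beta_confluent {M N P : Lam} (hN : ReflTransGen Beta M N) (hP : ReflTransGen Beta M P) :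
    Join (ReflTransGen Beta) N P := by
  obtain ⟨C, hC, rfl⟩ := Clk.exists_red_of_betas hN
  obtain ⟨D, hD, rfl⟩ := Clk.exists_red_of_betas hP
  obtain ⟨Z, hCZ, hDZ⟩ := hC.confluent hD
  exact ⟨Z.erase, hCZ.erase, hDZ.erase⟩

theorem Conv.join {M N : Lam} (h : Conv M N) : Join (ReflTransGen Beta) M N := by
  induction h with
  | rel M N h => exact ⟨N, .single h, .refl⟩
  | refl M => exact ⟨M, .refl, .refl⟩
  | symm M N _ ih => obtain ⟨Z, h, h'⟩ := ih; exact ⟨Z, h', h⟩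
  | trans M N P _ _ ih ih' =>
    obtain ⟨Z, hMZ, hNZ⟩ := ih
    obtain ⟨Z', hNZ', hPZ'⟩ := ih'
    obtain ⟨W, hZW, hZ'W⟩ := beta_confluent hNZ hNZ'
    exact ⟨W, hMZ.trans hZW, hPZ'.trans hZ'W⟩

theorem conv_of_betas {M N : Lam} (h : ReflTransGen Beta M N) : Conv M N := by
  induction h with
  | refl => exact .refl _
  | tail _ h ih => exact ih.trans _ _ _ (.rel _ _ h)

end Lam

/-! ### Substitution and normal forms of lambda-terms -/

namespace Lam

theorem subst_rename (M : Lam) (s : ℕ → Lam) (r : ℕ → ℕ) :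
    subst s (rename r M) = subst (s ∘ r) M := by
  induction M generalizing s r with
  | var k => rfl
  | lam M ih =>
    simp only [rename, subst, ih]
    congr 2
    funext k; cases k <;> rfl
  | app M N ihM ihN => simp [rename, subst, ihM, ihN]

theorem subst_var (M : Lam) : subst var M = M := by
  induction M with
  | var k => rfl
  | lam M ih =>
    have : liftSub var = var := by funext k; cases k <;> rfl
    simp [subst, this, ih]
  | app M N ihM ihN => simp [subst, ihM, ihN]

@[simp]
theorem subst_single_rename_succ (M N : Lam) : subst (single N) (rename Nat.succ M) = M := by
  rw [subst_rename]
  exact subst_var M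

theorem isNormal_var (k : ℕ) : IsNormal (var k) := fun _ h => nomatch h

theorem IsNormal.lam {M : Lam} (h : IsNormal M) : IsNormal (lam M) := by
  intro _ h'
  cases h' with | lam h' => exact h _ h'

theorem IsNormal.app {M N : Lam} (hM : IsNormal M) (hM' : ∀ P, M ≠ .lam P) (hN : IsNormal N) :
    IsNormal (app M N) := by
  intro _ h
  cases h with
  | beta => exact hM' _ rfl
  | appL _ h => exact hM _ h
  | appR _ h => exact hN _ h

theorem isNormal_omegaF : IsNormal omegaF := by
  refine .lam (.app (isNormal_var _) nofun (.app ?_ nofun ?_)) <;> exact isNormal_var _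

theorem isNormal_eta : IsNormal eta := by
  refine .lam (.lam (.app (isNormal_var _) nofun (.app (.app ?_ nofun ?_) nofun ?_))) <;>
    exact isNormal_var _

theorem isNormal_delta : IsNormal delta := by
  refine .lam (.lam (.app (isNormal_var _) nofun (.app ?_ nofun ?_))) <;> exact isNormal_var _

theorem iterate_app_ne_lam {M P : Lam} (hP : ∀ Q, P ≠ lam Q) (k : ℕ) (Q : Lam) :
    (app M)^[k] P ≠ lam Q := by
  cases k with
  | zero => exact hP Q
  | succ k => rw [Function.iterate_succ_apply']; nofun

theorem rename_iterate_app (r : ℕ → ℕ) (M P : Lam) (k : ℕ) :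
    rename r ((app M)^[k] P) = (app (rename r M))^[k] (rename r P) := by
  induction k with
  | zero => rfl
  | succ k ih => simp only [Function.iterate_succ_apply', rename, ih]

theorem subst_iterate_app (s : ℕ → Lam) (M P : Lam) (k : ℕ) :
    subst s ((app M)^[k] P) = (app (subst s M))^[k] (subst s P) := by
  induction k with
  | zero => rfl
  | succ k ih => simp only [Function.iterate_succ_apply', subst, ih]

theorem Beta.of_iterate_app_var {i k : ℕ} {P Q : Lam} (h : Beta ((app (var i))^[k] P) Q) :
    ∃ P', Beta P P' ∧ Q = (app (var i))^[k] P' := by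
  induction k generalizing Q with
  | zero => exact ⟨Q, h, rfl⟩
  | succ k ih =>
    rw [Function.iterate_succ_apply'] at h
    cases h with
    | appL _ h => cases h
    | appR _ h =>
      obtain ⟨P', hP', rfl⟩ := ih h
      exact ⟨P', hP', (Function.iterate_succ_apply' _ _ _).symm⟩

/-! ### The reducts of the Boehm sequence -/

/-- The reducts of Curry's fixed point combinator. -/
def curryReduct (k : ℕ) : Lam := lam ((app (var 0))^[k] (app omegaF omegaF))

theorem Beta.of_curryReduct {k : ℕ} {N : Lam} (h : Beta (curryReduct k) N) :
    N = curryReduct (k + 1) := by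
  cases h with
  | lam h =>
    obtain ⟨P, hP, rfl⟩ := h.of_iterate_app_var
    cases hP with
    | beta => rfl
    | appL _ h' => exact (isNormal_omegaF _ h').elim
    | appR _ h' => exact (isNormal_omegaF _ h').elim

theorem exists_eq_curryReduct {N : Lam} (h : ReflTransGen Beta curryY N) :
    ∃ k, N = curryReduct k := by
  induction h with
  | refl => exact ⟨0, rfl⟩
  | tail _ h ih =>
    obtain ⟨k, rfl⟩ := ih
    exact ⟨k + 1, h.of_curryReduct⟩

/-- `BoehmReduct n M`, for `n ≥ 1`: a set of terms that contains the reducts of `Yₙ`. -/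
inductive BoehmReduct : ℕ → Lam → Prop
  | etaEta : BoehmReduct 1 (app eta eta)
  | lam {n : ℕ} {M : Lam} (k : ℕ) :
      BoehmReduct n M → BoehmReduct n (lam ((app (var 0))^[k + 1] (app M (var 0))))
  | appDelta {n : ℕ} {M : Lam} : BoehmReduct n M → BoehmReduct (n + 1) (app M delta)
  | deltaApp {n : ℕ} {M : Lam} : BoehmReduct (n + 1) M → BoehmReduct (n + 1) (app delta M)

theorem BoehmReduct.rename_eq {n : ℕ} {M : Lam} (h : BoehmReduct n M) (r : ℕ → ℕ) :
    rename r M = M := by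
  induction h generalizing r with
  | etaEta => rfl
  | lam k _ ih => simp [rename, rename_iterate_app, ih, liftRen, -Function.iterate_succ]
  | appDelta _ ih => simp [rename, ih]; rfl
  | deltaApp _ ih => simp [rename, ih]; rfl

theorem BoehmReduct.subst_eq {n : ℕ} {M : Lam} (h : BoehmReduct n M) (s : ℕ → Lam) :
    subst s M = M := by
  induction h generalizing s with
  | etaEta => rfl
  | lam k _ ih => simp [subst, subst_iterate_app, ih, liftSub, -Function.iterate_succ]
  | appDelta _ ih => simp [subst, ih]; rfl
  | deltaApp _ ih => simp [subst, ih]; rfl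

theorem BoehmReduct.ne_var {n : ℕ} {M : Lam} (h : BoehmReduct n M) (k : ℕ) : M ≠ var k := by
  cases h <;> nofun

theorem BoehmReduct.of_lam {n : ℕ} {M : Lam} (h : BoehmReduct n (Lam.lam M)) :
    ∃ k N, BoehmReduct n N ∧ M = (app (var 0))^[k + 1] (app N (var 0)) := by
  cases h with
  | lam k h => exact ⟨k, _, h, rfl⟩

theorem not_boehmReduct_lam_lam (n : ℕ) (M : Lam) : ¬ BoehmReduct n (lam (lam M)) := by
  intro h
  obtain ⟨k, N, _, h⟩ := h.of_lam
  exact iterate_app_ne_lam (P := app N (var 0)) nofun _ _ h.symm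

theorem inst_iterate_app {n : ℕ} {M : Lam} (h : BoehmReduct n M) (k : ℕ) (N : Lam) :
    inst ((app (var 0))^[k] (app M (var 0))) N = (app N)^[k] (app M N) := by
  simp [inst, subst_iterate_app, subst, h.subst_eq, single]

theorem BoehmReduct.iterate_deltaApp {n : ℕ} {M : Lam} (h : BoehmReduct (n + 1) M) (k : ℕ) :
    BoehmReduct (n + 1) ((app delta)^[k] M) := by
  induction k with
  | zero => exact h
  | succ k ih => rw [Function.iterate_succ_apply']; exact ih.deltaApp

/-- Since all these terms are closed, contracting `λf. fʲ⁺¹(M f)` against `δ` gives `δʲ⁺¹(M δ)`: of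
the copies of `δ` only the last is an argument of `M`, the others are heads, so the index is
unchanged. Against a variable, contraction only lengthens the tower of heads. -/
theorem BoehmReduct.beta {n : ℕ} {M N : Lam} (h : BoehmReduct n M) (hMN : Beta M N) :
    BoehmReduct n N := by
  induction h generalizing N with
  | etaEta =>
    cases hMN with
    | beta => exact .lam 0 .etaEta
    | appL _ h => exact (isNormal_eta _ h).elim
    | appR _ h => exact (isNormal_eta _ h).elim
  | @lam n M k hM ih =>
    cases hMN with
    | lam h =>
      obtain ⟨P, hP, rfl⟩ := h.of_iterate_app_var
      cases hP with
      | beta M =>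
        obtain ⟨j, M, hM', rfl⟩ := hM.of_lam
        rw [inst_iterate_app hM', ← Function.iterate_add_apply]
        exact .lam (k + 1 + j) hM'
      | appL _ h' => exact .lam k (ih h')
      | appR _ h' => exact (isNormal_var _ _ h').elim
  | @appDelta n M hM ih =>
    cases hMN with
    | beta M =>
      obtain ⟨j, M, hM', rfl⟩ := hM.of_lam
      rw [inst_iterate_app hM']
      exact hM'.appDelta.iterate_deltaApp _
    | appL _ h => exact (ih h).appDelta
    | appR _ h => exact (isNormal_delta _ h).elim
  | @deltaApp n M hM ih =>
    cases hMN with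
    | beta =>
      -- The contractum contains `M` shifted under a binder; as `M` is closed, the shift is the
      -- identity.
      have := BoehmReduct.lam 0 hM
      rw [← hM.rename_eq Nat.succ] at this
      exact this
    | appL _ h => exact (isNormal_delta _ h).elim
    | appR _ h => exact (ih h).deltaApp

theorem BoehmReduct.betas {n : ℕ} {M N : Lam} (h : BoehmReduct n M)
    (hMN : ReflTransGen Beta M N) : BoehmReduct n N := by
  induction hMN with
  | refl => exact h
  | tail _ h' ih => exact ih.beta h'

/-- As `M` and `N` differ from the variable of the tower, the end of the tower is recognisable and
the two heights agree. -/
theorem eq_of_iterate_app_eq {i j k : ℕ} {M N : Lam} (hM : M ≠ var i) (hN : N ≠ var i)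
    (h : (app (var i))^[j] (app M (var i)) = (app (var i))^[k] (app N (var i))) : M = N := by
  induction j generalizing k with
  | zero =>
    cases k with
    | zero => exact (app.inj h).1
    | succ k => rw [Function.iterate_succ_apply'] at h; exact (hM (app.inj h).1).elim
  | succ j ih =>
    rw [Function.iterate_succ_apply'] at h
    cases k with
    | zero => exact (hN (app.inj h).1.symm).elim
    | succ k => rw [Function.iterate_succ_apply'] at h; exact ih (app.inj h).2

/-- The only possible overlap of two clauses is `δ δ`, an instance of both `M δ` and `δ M`; it is
excluded because `δ` starts with two abstractions, unlike every term of the set. -/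
theorem BoehmReduct.index_unique {m n : ℕ} {M : Lam} (hm : BoehmReduct m M)
    (hn : BoehmReduct n M) : m = n := by
  induction hm generalizing n with
  | etaEta => cases hn; rfl
  | lam k hM ih =>
    obtain ⟨j, N, hN, h⟩ := hn.of_lam
    rw [eq_of_iterate_app_eq (hM.ne_var 0) (hN.ne_var 0) h] at ih
    exact ih hN
  | appDelta hM ih =>
    cases hn with
    | appDelta h => rw [ih h]
    | deltaApp h => exact (not_boehmReduct_lam_lam _ _ hM).elim
  | deltaApp hM ih =>
    cases hn with
    | appDelta h => exact (not_boehmReduct_lam_lam _ _ h).elim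
    | deltaApp h => exact ih h

/-- Peeling off equal heads would end by matching `ω_f ω_f` with a term whose head or whose argument
is the bound variable, or by making a `BoehmReduct` equal to a variable. -/
theorem not_boehmReduct_curryReduct (n k : ℕ) : ¬ BoehmReduct n (curryReduct k) := by
  intro h
  obtain ⟨j, N, hN, h⟩ := h.of_lam
  clear * - hN h
  induction k generalizing j with
  | zero => rw [Function.iterate_succ_apply'] at h; cases h
  | succ k ih =>
    rw [Function.iterate_succ_apply', Function.iterate_succ_apply'] at h
    cases j with
    | zero =>
      cases k with
      | zero => cases (app.inj h).2
      | succ k =>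
        rw [Function.iterate_succ_apply'] at h
        exact hN.ne_var 0 (app.inj (app.inj h).2).1.symm
    | succ j => exact ih j (app.inj h).2

theorem leftIter_succ (M N : Lam) (n : ℕ) : leftIter M N (n + 1) = app (leftIter M N n) N := by
  induction n generalizing M with
  | zero => rfl
  | succ n ih => exact ih (app M N)

theorem boehmY_succ_succ (n : ℕ) : boehmY (n + 2) = app (boehmY (n + 1)) delta :=
  leftIter_succ _ _ n

theorem boehmReduct_boehmY (n : ℕ) : BoehmReduct (n + 1) (boehmY (n + 1)) := by
  induction n with
  | zero => exact .etaEta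
  | succ n ih => rw [boehmY_succ_succ]; exact ih.appDelta

theorem not_conv_curryY (n : ℕ) : ¬ Conv curryY (boehmY (n + 1)) := by
  intro h
  obtain ⟨Z, h, h'⟩ := h.join
  obtain ⟨k, rfl⟩ := exists_eq_curryReduct h
  exact not_boehmReduct_curryReduct _ _ ((boehmReduct_boehmY n).betas h')

theorem boehmY_not_conv {m n : ℕ} (hmn : m ≠ n) : ¬ Conv (boehmY m) (boehmY n) := by
  intro h
  cases m with
  | zero =>
    cases n with
    | zero => exact hmn rfl
    | succ n => exact not_conv_curryY n h
  | succ m =>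
    cases n with
    | zero => exact not_conv_curryY m (.symm _ _ h)
    | succ n =>
      obtain ⟨Z, h, h'⟩ := h.join
      exact hmn (((boehmReduct_boehmY m).betas h).index_unique ((boehmReduct_boehmY n).betas h'))

/-! ### Simplicity and the fixed point property -/

theorem SimpleHead.beta_step {M N : Lam} (h : SimpleHead M N) : Beta M N := by
  induction h with
  | beta => exact .beta _ _
  | appL N _ ih => exact .appL N ih

theorem betas_of_simpleHeads {M N : Lam} (h : ReflTransGen SimpleHead M N) :
    ReflTransGen Beta M N :=
  ReflTransGen.mono (fun _ _ => SimpleHead.beta_step) _ _ h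

theorem betas_appL {M M' : Lam} (N : Lam) (h : ReflTransGen Beta M M') :
    ReflTransGen Beta (app M N) (app M' N) :=
  h.lift (fun M => app M N) fun _ _ => Beta.appL N

theorem simpleHeads_appL {M M' : Lam} (N : Lam) (h : ReflTransGen SimpleHead M M') :
    ReflTransGen SimpleHead (app M N) (app M' N) :=
  h.lift (fun M => app M N) fun _ _ => SimpleHead.appL N

/-- The abstraction to which `δ M` reduces. -/
def deltaBody (M : Lam) : Lam := lam (app (var 0) (app (rename Nat.succ M) (var 0)))

theorem inst_deltaBody (M N : Lam) :
    inst (app (var 0) (app (rename Nat.succ M) (var 0))) N = app N (app M N) := by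
  simp [inst, subst, single]

theorem simpleHead_deltaApp {M : Lam} : SimpleHead (app delta M) (deltaBody M) :=
  .beta (.inl (by decide))

/-- The bound variable of `η` occurs twice, so simplicity rests on `η` being normal; for `δ M` it
rests on linearity instead, as `M` need not be normal. -/
theorem simpleHead_etaEta : SimpleHead (app eta eta) (deltaBody (app eta eta)) :=
  .beta (.inr isNormal_eta)

theorem beta_deltaBody (M N : Lam) : Beta (app (deltaBody M) N) (app N (app M N)) := by
  have := Beta.beta (app (var 0) (app (rename Nat.succ M) (var 0))) N
  rwa [inst_deltaBody] at this

theorem simpleHead_deltaBody (M : Lam) {N : Lam} (hN : IsNormal N) :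
    SimpleHead (app (deltaBody M) N) (app N (app M N)) := by
  have := SimpleHead.beta (M := app (var 0) (app (rename Nat.succ M) (var 0))) (.inr hN)
  rwa [inst_deltaBody] at this

theorem boehmY_simpleHeads_deltaBody (n : ℕ) :
    ReflTransGen SimpleHead (boehmY (n + 1)) (deltaBody (boehmY (n + 1))) := by
  induction n with
  | zero => exact .single simpleHead_etaEta
  | succ n ih =>
    rw [boehmY_succ_succ]
    exact ((simpleHeads_appL _ ih).tail (simpleHead_deltaBody _ isNormal_delta)).tail
      simpleHead_deltaApp

theorem boehmY_app_simpleHeads (n : ℕ) {N : Lam} (hN : IsNormal N) :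
    ReflTransGen SimpleHead (app (boehmY (n + 1)) N) (app N (app (boehmY (n + 1)) N)) :=
  (simpleHeads_appL N (boehmY_simpleHeads_deltaBody n)).tail (simpleHead_deltaBody _ hN)

theorem boehmY_app_betas (n : ℕ) (N : Lam) :
    ReflTransGen Beta (app (boehmY (n + 1)) N) (app N (app (boehmY (n + 1)) N)) :=
  (betas_appL N (betas_of_simpleHeads (boehmY_simpleHeads_deltaBody n))).tail
    (beta_deltaBody _ N)

/-- `ω_N = λx. N (x x)`. -/
def omega (N : Lam) : Lam := lam (app (rename Nat.succ N) (app (var 0) (var 0)))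

theorem inst_omega (M N : Lam) :
    inst (app (rename Nat.succ M) (app (var 0) (var 0))) N = app M (app N N) := by
  simp [inst, subst, single]

theorem beta_omega (N : Lam) :
    Beta (app (omega N) (omega N)) (app N (app (omega N) (omega N))) := by
  have := Beta.beta (app (rename Nat.succ N) (app (var 0) (var 0))) (omega N)
  rwa [inst_omega] at this

theorem beta_curryY (N : Lam) : Beta (app curryY N) (app (omega N) (omega N)) :=
  .beta _ _

theorem simpleHead_omega_var (x : ℕ) :
    SimpleHead (app (omega (var x)) (omega (var x)))
      (app (var x) (app (omega (var x)) (omega (var x)))) := by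
  have : IsNormal (omega (var x)) := by
    refine .lam (.app (isNormal_var _) nofun (.app ?_ nofun ?_)) <;> exact isNormal_var _
  exact .beta (.inr this)

theorem closed_boehmY (n : ℕ) : Closed (boehmY n) := by
  intro k
  match n with
  | 0 => simp [boehmY, curryY, omegaF, occ]
  | n + 1 =>
    induction n with
    | zero => simp [boehmY, leftIter, eta, occ]
    | succ n ih => rw [boehmY_succ_succ, occ, ih]; simp [delta, occ]

theorem isFixedPointCombinator_boehmY (n : ℕ) : IsFixedPointCombinator (boehmY n) := by
  refine ⟨closed_boehmY n, fun F => ?_⟩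
  cases n with
  | zero =>
    exact .trans _ _ _ (.trans _ _ _ (.rel _ _ (beta_curryY F)) (.rel _ _ (beta_omega F)))
      (.symm _ _ (.rel _ _ (.appR F (beta_curryY F))))
  | succ n => exact conv_of_betas (boehmY_app_betas n F)

/-- The terms met in the unfolding of `Yₙ` and `Yₙ x`. -/
inductive BoehmSubterm : Lam → Prop
  | var (x : ℕ) : BoehmSubterm (var x)
  | boehmY (n : ℕ) : BoehmSubterm (boehmY n)
  | boehmYApp (n x : ℕ) : BoehmSubterm (app (boehmY n) (var x))
  | omegaApp (x : ℕ) : BoehmSubterm (app (omega (var x)) (omega (var x)))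
  | body (n x : ℕ) : BoehmSubterm (app (var x) (app (boehmY n) (var x)))

theorem BoehmSubterm.simpleLayer {M : Lam} (h : BoehmSubterm M) :
    SimpleLayer BoehmSubterm M := by
  cases h with
  | var x => exact .inr (.inr ⟨_, .refl, .var x⟩)
  | boehmY n =>
    refine .inr (.inl ?_)
    cases n with
    | zero => exact ⟨_, .refl, .omegaApp 0⟩
    | succ n =>
      refine ⟨_, boehmY_simpleHeads_deltaBody n, ?_⟩
      rw [(boehmReduct_boehmY n).rename_eq]
      exact .body (n + 1) 0
  | boehmYApp n x =>
    refine .inr (.inr ?_)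
    cases n with
    | zero =>
      exact ⟨_, .tail (.single (.beta (.inr (isNormal_var x)))) (simpleHead_omega_var x),
        .app (.var x) (.omegaApp x)⟩
    | succ n => exact ⟨_, boehmY_app_simpleHeads n (isNormal_var x), .app (.var x) (.boehmYApp _ x)⟩
  | omegaApp x =>
    exact .inr (.inr ⟨_, .single (simpleHead_omega_var x), .app (.var x) (.omegaApp x)⟩)
  | body n x => exact .inr (.inr ⟨_, .refl, .app (.var x) (.boehmYApp n x)⟩)

theorem BoehmSubterm.simple {M : Lam} (h : BoehmSubterm M) : Simple M :=
  ⟨BoehmSubterm, fun _ => BoehmSubterm.simpleLayer, h⟩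

end Lam

/-! ### Shape of reducts, read from the leftmost symbol -/

namespace Clk

/-- The leftmost symbol of the term, below its applications, is not a variable. -/
def Active : Clk → Prop
  | var _ => False
  | lam _ => True
  | app M _ => Active M
  | tau _ => True

/-- The number of applications above the leftmost symbol. -/
def spineLength : Clk → ℕ
  | app M _ => spineLength M + 1
  | _ => 0

/-- A contraction on the spine needs a leftmost `λ` or `τ` and leaves a `τ`; any other step keeps
the leftmost symbol. -/
theorem Step.active_iff {M N : Clk} (h : Step M N) : Active M ↔ Active N := by
  induction h with
  | appL N _ ih => exact ih
  | _ => exact Iff.rfl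

theorem Step.spineLength_le {M N : Clk} (h : Step M N) : spineLength N ≤ spineLength M := by
  induction h with
  | appL N _ ih => exact Nat.succ_le_succ ih
  | _ => simp [spineLength]

theorem Red.active_iff {M N : Clk} (h : Red M N) : Active M ↔ Active N := by
  induction h with
  | refl => exact Iff.rfl
  | tail _ h ih => exact ih.trans h.active_iff

theorem Red.spineLength_le {M N : Clk} (h : Red M N) : spineLength N ≤ spineLength M := by
  induction h with
  | refl => exact le_rfl
  | tail _ h ih => exact h.spineLength_le.trans ih

theorem Red.of_var {k : ℕ} {N : Clk} (h : Red (var k) N) : N = var k := by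
  induction h with
  | refl => rfl
  | tail _ h ih => subst ih; cases h

theorem Red.of_lam {M N : Clk} (h : Red (Clk.lam M) N) : ∃ M', N = Clk.lam M' ∧ Red M M' := by
  induction h with
  | refl => exact ⟨M, rfl, .refl⟩
  | tail _ h ih =>
    obtain ⟨M', rfl, hM⟩ := ih
    cases h with | lam h => exact ⟨_, rfl, hM.tail h⟩

theorem Red.of_tau {M N : Clk} (h : Red (Clk.tau M) N) : ∃ M', N = Clk.tau M' ∧ Red M M' := by
  induction h with
  | refl => exact ⟨M, rfl, .refl⟩
  | tail _ h ih =>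
    obtain ⟨M', rfl, hM⟩ := ih
    cases h with | tau h => exact ⟨_, rfl, hM.tail h⟩

/-- A spine headed by a variable never turns into a redex, so its root application is permanent. -/
theorem Red.of_app {M N P : Clk} (h : Red (Clk.app M N) P) (hM : ¬ Active M) :
    ∃ M' N', P = Clk.app M' N' ∧ Red M M' ∧ Red N N' := by
  induction h with
  | refl => exact ⟨M, N, rfl, .refl, .refl⟩
  | tail _ h ih =>
    obtain ⟨M', N', rfl, hMM', hN⟩ := ih
    cases h with
    | beta => exact (hM (hMM'.active_iff.2 trivial)).elim
    | move => exact (hM (hMM'.active_iff.2 trivial)).elim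
    | appL _ h => exact ⟨_, _, rfl, hMM'.tail h, hN⟩
    | appR _ h => exact ⟨_, _, rfl, hMM', hN.tail h⟩

end Clk

/-! ### Constructors of infinite terms -/

namespace Tree

theorem tau_injective {T U : Tree} (h : tau T = tau U) : T = U :=
  congrFun (eq_of_heq (Sigma.mk.inj (PFunctor.M.mk_inj h)).2) (0 : Fin 1)

theorem app_injective {T T' U U' : Tree} (h : app T U = app T' U') : T = T' ∧ U = U' := by
  have := eq_of_heq (Sigma.mk.inj (PFunctor.M.mk_inj h)).2
  exact ⟨congrFun this (0 : Fin 2), congrFun this (1 : Fin 2)⟩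

theorem root_eq {T U : Tree} (h : T = U) : T.dest.1 = U.dest.1 := by rw [h]

theorem app_ne_var (T U : Tree) (k : ℕ) : app T U ≠ var k := fun h => nomatch root_eq h
theorem lam_ne_var (T : Tree) (k : ℕ) : lam T ≠ var k := fun h => nomatch root_eq h
theorem tau_ne_var (T : Tree) (k : ℕ) : tau T ≠ var k := fun h => nomatch root_eq h
theorem lam_ne_app (T U V : Tree) : lam T ≠ app U V := fun h => nomatch root_eq h
theorem tau_ne_app (T U V : Tree) : tau T ≠ app U V := fun h => nomatch root_eq h
theorem lam_ne_tau (T U : Tree) : lam T ≠ tau U := fun h => nomatch root_eq h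

end Tree

/-! ### Uniqueness of infinitary normal forms -/

theorem InfRed.unfold {M : Clk} {T : Tree} (h : InfRed M T) :
    ∃ N, Clk.Red M N ∧ RootMatch InfRed N T := by
  obtain ⟨R, hR, hMT⟩ := h
  obtain ⟨N, hMN, hNT⟩ := hR M T hMT
  refine ⟨N, hMN, ?_⟩
  cases hNT with
  | var k => exact .var k
  | lam h => exact .lam ⟨R, hR, h⟩
  | app h h' => exact .app ⟨R, hR, h⟩ ⟨R, hR, h'⟩
  | tau h => exact .tau ⟨R, hR, h⟩

/-- The relation in the conclusion of `InfRed.unfold` is itself admissible in the coinductive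
definition. -/
theorem InfRed.fold {M N : Clk} {T : Tree} (hMN : Clk.Red M N) (h : RootMatch InfRed N T) :
    InfRed M T := by
  refine ⟨fun M T => ∃ N, Clk.Red M N ∧ RootMatch InfRed N T, ?_, N, hMN, h⟩
  rintro M T ⟨N, hMN, h⟩
  refine ⟨N, hMN, ?_⟩
  cases h with
  | var k => exact .var k
  | lam h => exact .lam h.unfold
  | app h h' => exact .app h.unfold h'.unfold
  | tau h => exact .tau h.unfold

namespace Tree

theorem IsNormal.of_lam {T : Tree} (h : IsNormal (lam T)) : IsNormal T := fun h' => h (.lam h')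
theorem IsNormal.of_tau {T : Tree} (h : IsNormal (tau T)) : IsNormal T := fun h' => h (.tau h')
theorem IsNormal.of_appL {T U : Tree} (h : IsNormal (app T U)) : IsNormal T :=
  fun h' => h (.appL U h')
theorem IsNormal.of_appR {T U : Tree} (h : IsNormal (app T U)) : IsNormal U :=
  fun h' => h (.appR T h')

end Tree

/-- If the root were an application, its left part would come from an active term with a shorter
spine, hence by induction be an abstraction or a `τ`, and the root would be a redex. The induction
is well-founded because terms are finite and reduction never lengthens the spine. -/
theorem InfRed.of_active {M : Clk} {T : Tree} (h : InfRed M T) (hT : T.IsNormal)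
    (hM : M.Active) : (∃ U, T = .lam U) ∨ ∃ U, T = .tau U := by
  induction hn : M.spineLength using Nat.strong_induction_on generalizing M T with
  | _ n ih =>
    obtain ⟨N, hMN, hNT⟩ := h.unfold
    have hN := hMN.active_iff.1 hM
    have hl := hMN.spineLength_le
    cases hNT with
    | var k => exact hN.elim
    | lam _ => exact .inl ⟨_, rfl⟩
    | tau _ => exact .inr ⟨_, rfl⟩
    | @app M₁ M₂ T₁ T₂ h₁ h₂ =>
      rw [Clk.spineLength] at hl
      rcases ih _ (by omega) h₁ hT.of_appL hN rfl with ⟨U, rfl⟩ | ⟨U, rfl⟩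
      · exact (hT (.beta _ _)).elim
      · exact (hT (.move _ _)).elim

/-- Matching of the roots of two trees, with `R` relating their immediate subtrees. -/
inductive TreeMatch (R : Tree → Tree → Prop) : Tree → Tree → Prop
  | var (k : ℕ) : TreeMatch R (.var k) (.var k)
  | lam {T U : Tree} : R T U → TreeMatch R (.lam T) (.lam U)
  | app {T T' U U' : Tree} : R T U → R T' U' → TreeMatch R (.app T T') (.app U U')
  | tau {T U : Tree} : R T U → TreeMatch R (.tau T) (.tau U)

theorem Tree.eq_of_bisim (R : Tree → Tree → Prop) (hR : ∀ T U, R T U → TreeMatch R T U)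
    {T U : Tree} (h : R T U) : T = U := by
  refine PFunctor.M.bisim R (fun T U hTU => ?_) T U h
  cases hR T U hTU with
  | var k => exact ⟨Node.var k, _, _, rfl, rfl, fun i => i.elim0⟩
  | lam h => exact ⟨Node.lam, _, _, rfl, rfl, fun _ => h⟩
  | tau h => exact ⟨Node.tau, _, _, rfl, rfl, fun _ => h⟩
  | app h h' =>
    refine ⟨Node.app, _, _, rfl, rfl, fun i => ?_⟩
    match i with
    | (0 : Fin 2) => exact h
    | (1 : Fin 2) => exact h'

/-- Joinable terms are both active or both inactive. In the active case normality forces a root `λ`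
or `τ`, in the inactive case a variable or an application headed by a variable. Such roots survive
reduction, so both agree with the root of the common reduct, whose subterms join the subterms. -/
theorem treeMatch_of_join {M N : Clk} {T U : Tree} (hT : InfRed M T) (hU : InfRed N U)
    (nT : T.IsNormal) (nU : U.IsNormal) (h : Join Clk.Red M N) :
    TreeMatch (fun T U => ∃ M N, InfRed M T ∧ InfRed N U ∧ T.IsNormal ∧ U.IsNormal ∧
      Join Clk.Red M N) T U := by
  obtain ⟨M', hM, hMT⟩ := hT.unfold
  obtain ⟨N', hN, hNU⟩ := hU.unfold
  obtain ⟨Z, hMZ, hNZ⟩ := Clk.join_of_red h hM hN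
  have hact : M.Active ↔ N.Active := by
    rw [hM.active_iff, hN.active_iff, hMZ.active_iff, hNZ.active_iff]
  by_cases ha : M.Active
  · have hT' := hT.of_active nT ha
    have hU' := hU.of_active nU (hact.1 ha)
    cases hMT with
    | var k => exact ((hM.active_iff.1 ha).elim)
    | app => simp [Tree.lam_ne_app, Tree.tau_ne_app, eq_comm (a := Tree.app _ _)] at hT'
    | lam h =>
      obtain ⟨P, rfl, hP⟩ := hMZ.of_lam
      cases hNU with
      | var k => exact (hN.active_iff.1 (hact.1 ha)).elim
      | app => simp [Tree.lam_ne_app, Tree.tau_ne_app, eq_comm (a := Tree.app _ _)] at hU'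
      | tau => obtain ⟨Q, hQ, _⟩ := hNZ.of_tau; cases hQ
      | lam h' =>
        obtain ⟨Q, hQ, hQ'⟩ := hNZ.of_lam
        cases hQ
        exact .lam ⟨_, _, h, h', nT.of_lam, nU.of_lam, _, hP, hQ'⟩
    | tau h =>
      obtain ⟨P, rfl, hP⟩ := hMZ.of_tau
      cases hNU with
      | var k => exact (hN.active_iff.1 (hact.1 ha)).elim
      | app => simp [Tree.lam_ne_app, Tree.tau_ne_app, eq_comm (a := Tree.app _ _)] at hU'
      | lam => obtain ⟨Q, hQ, _⟩ := hNZ.of_lam; cases hQ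
      | tau h' =>
        obtain ⟨Q, hQ, hQ'⟩ := hNZ.of_tau
        cases hQ
        exact .tau ⟨_, _, h, h', nT.of_tau, nU.of_tau, _, hP, hQ'⟩
  · have hM' : ¬ M'.Active := fun h => ha (hM.active_iff.2 h)
    have hN' : ¬ N'.Active := fun h => ha (hact.2 (hN.active_iff.2 h))
    cases hMT with
    | lam => exact (hM' trivial).elim
    | tau => exact (hM' trivial).elim
    | var k =>
      obtain rfl := hMZ.of_var
      cases hNU with
      | lam => exact (hN' trivial).elim
      | tau => exact (hN' trivial).elim
      | var j => cases hNZ.of_var; exact .var _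
      | app => obtain ⟨_, _, h, _⟩ := hNZ.of_app hN'; cases h
    | app h₁ h₂ =>
      obtain ⟨P₁, P₂, rfl, hP₁, hP₂⟩ := hMZ.of_app hM'
      cases hNU with
      | lam => exact (hN' trivial).elim
      | tau => exact (hN' trivial).elim
      | var j => cases hNZ.of_var
      | app h₁' h₂' =>
        obtain ⟨Q₁, Q₂, hQ, hQ₁, hQ₂⟩ := hNZ.of_app hN'
        cases hQ
        exact .app ⟨_, _, h₁, h₁', nT.of_appL, nU.of_appL, _, hP₁, hQ₁⟩
          ⟨_, _, h₂, h₂', nT.of_appR, nU.of_appR, _, hP₂, hQ₂⟩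

theorem IsClockedLevyTree.unique {M : Lam} {T U : Tree} (hT : IsClockedLevyTree M T)
    (hU : IsClockedLevyTree M U) : T = U := by
  refine Tree.eq_of_bisim (fun T U => ∃ M N, InfRed M T ∧ InfRed N U ∧ T.IsNormal ∧ U.IsNormal ∧
    Join Clk.Red M N) ?_ ⟨_, _, hT.1, hU.1, hT.2, hU.2, Clk.ofLam M, .refl, .refl⟩
  rintro T U ⟨M, N, hT, hU, nT, nU, h⟩
  exact treeMatch_of_join hT hU nT nU h

/-! ### Periodic trees -/

namespace Tree

/-- The generator of the tree `S` with `S = τᶜ(x S)`: `some k` generates `τᵏ(x S)` and `none` generates `x`. -/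
def periodicFrom (c x : ℕ) : Option ℕ → Tree :=
  PFunctor.M.corec fun
    | none => ⟨Node.var x, Fin.elim0⟩
    | some 0 => ⟨Node.app, ![none, some c]⟩
    | some (k + 1) => ⟨Node.tau, fun _ => some k⟩

/-- The tree `S` with `S = τᶜ(x S)`. -/
def periodic (c x : ℕ) : Tree := periodicFrom c x (some c)

theorem periodicFrom_none (c x : ℕ) : periodicFrom c x none = var x := by
  rw [periodicFrom, PFunctor.M.corec_def]
  refine congrArg PFunctor.M.mk (Sigma.ext rfl (heq_of_eq ?_))
  funext i; exact i.elim0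

theorem periodicFrom_zero (c x : ℕ) :
    periodicFrom c x (some 0) = app (var x) (periodic c x) := by
  rw [← periodicFrom_none c x, periodicFrom, PFunctor.M.corec_def]
  refine congrArg PFunctor.M.mk (Sigma.ext rfl (heq_of_eq ?_))
  funext i
  match i with
  | (0 : Fin 2) => rfl
  | (1 : Fin 2) => rfl

theorem periodicFrom_some (c x k : ℕ) :
    periodicFrom c x (some k) = tau^[k] (app (var x) (periodic c x)) := by
  induction k with
  | zero => exact periodicFrom_zero c x
  | succ k ih =>
    rw [Function.iterate_succ_apply', ← ih]
    exact PFunctor.M.corec_def _ _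

theorem periodic_eq (c x : ℕ) : periodic c x = tau^[c] (app (var x) (periodic c x)) :=
  periodicFrom_some c x c

/-- The trees `x` and `τᵏ(x S)` include all subtrees of `S`. None is a redex, so induction on the
position of a redex excludes all of them at once. -/
theorem ne_periodic_of_hasRedex {c x : ℕ} {S T : Tree} (hS : S = tau^[c] (app (var x) S))
    (h : HasRedex T) : T ≠ var x ∧ ∀ k, T ≠ tau^[k] (app (var x) S) := by
  have app_case : ∀ U V : Tree, (∀ k, app U V ≠ tau^[k + 1] (app (var x) S)) := fun U V k h => by
    rw [Function.iterate_succ_apply'] at h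
    exact tau_ne_app _ _ _ h.symm
  induction h with
  | beta A B =>
    refine ⟨app_ne_var _ _ _, fun k => ?_⟩
    cases k with
    | zero => exact fun h => lam_ne_var _ _ (app_injective h).1
    | succ k => exact app_case _ _ k
  | move A B =>
    refine ⟨app_ne_var _ _ _, fun k => ?_⟩
    cases k with
    | zero => exact fun h => tau_ne_var _ _ (app_injective h).1
    | succ k => exact app_case _ _ k
  | lam _ _ =>
    refine ⟨lam_ne_var _ _, fun k => ?_⟩
    cases k with
    | zero => exact lam_ne_app _ _ _
    | succ k => rw [Function.iterate_succ_apply']; exact lam_ne_tau _ _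
  | appL U _ ih =>
    refine ⟨app_ne_var _ _ _, fun k => ?_⟩
    cases k with
    | zero => exact fun h => ih.1 (app_injective h).1
    | succ k => exact app_case _ _ k
  | appR T _ ih =>
    refine ⟨app_ne_var _ _ _, fun k => ?_⟩
    cases k with
    -- The argument of `x` is `S` itself, which is again of the excluded form, with exponent `c`.
    | zero => exact fun h => ih.2 c ((app_injective h).2.trans hS)
    | succ k => exact app_case _ _ k
  | tau _ ih =>
    refine ⟨tau_ne_var _ _, fun k => ?_⟩
    cases k with
    | zero => exact tau_ne_app _ _ _
    | succ k =>
      rw [Function.iterate_succ_apply']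
      exact fun h => ih.2 k (tau_injective h)

theorem isNormal_of_periodic {c x : ℕ} {S : Tree} (hS : S = tau^[c] (app (var x) S)) :
    IsNormal S := fun h => (ne_periodic_of_hasRedex hS h).2 c hS

theorem IsNormal.tau {T : Tree} (h : IsNormal T) : IsNormal (tau T) := by
  intro h'
  generalize hU : Tree.tau T = U at h'
  cases h' with
  | tau h' => exact h (tau_injective hU ▸ h')
  | lam _ => exact lam_ne_tau _ _ hU.symm
  | _ => exact tau_ne_app _ _ _ hU

end Tree

theorem infRed_of_periodic {c x : ℕ} {A : Clk} {S : Tree}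
    (hA : Clk.Red A (Clk.tau^[c] (.app (.var x) A)))
    (hS : S = Tree.tau^[c] (.app (.var x) S)) : InfRed A S := by
  refine ⟨fun N U => (N = .var x ∧ U = .var x) ∨ ∃ k, Clk.Red N (Clk.tau^[k] (.app (.var x) A)) ∧
    U = Tree.tau^[k] (.app (.var x) S), ?_, .inr ⟨c, hA, hS⟩⟩
  rintro N U (⟨rfl, rfl⟩ | ⟨k, hN, rfl⟩)
  · exact ⟨_, .refl, .var x⟩
  · refine ⟨_, hN, ?_⟩
    cases k with
    | zero => exact .app (.inl ⟨rfl, rfl⟩) (.inr ⟨c, hA, hS⟩)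
    | succ k =>
      rw [Function.iterate_succ_apply', Function.iterate_succ_apply']
      exact .tau (.inr ⟨k, .refl, rfl⟩)

/-! ### Clocked reduction of the Boehm sequence -/

namespace Clk

theorem red_app_iterate_tau (M N : Clk) (k : ℕ) :
    Red (app (tau^[k] M) N) (tau^[k] (app M N)) := by
  induction k with
  | zero => exact .refl
  | succ k ih =>
    rw [Function.iterate_succ_apply', Function.iterate_succ_apply']
    exact ih.tau.head (.move _ _)

theorem Red.iterate_tau {M N : Clk} (h : Red M N) (k : ℕ) :
    Red (Clk.tau^[k] M) (Clk.tau^[k] N) := by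
  induction k with
  | zero => exact h
  | succ k ih => rw [Function.iterate_succ_apply', Function.iterate_succ_apply']; exact ih.tau

/-- The abstraction to which `δ M` reduces. -/
def deltaBody (M : Clk) : Clk := lam (app (var 0) (app (rename Nat.succ M) (var 0)))

theorem step_deltaBody (M N : Clk) :
    Step (app (deltaBody M) N) (tau (app N (app M N))) := by
  have h := Step.beta (app (var 0) (app (rename Nat.succ M) (var 0))) N
  have : inst (app (var 0) (app (rename Nat.succ M) (var 0))) N = app N (app M N) := by
    simp [inst, subst, single]
  rwa [this] at h

theorem boehmY_red (n : ℕ) :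
    Red (ofLam (Lam.boehmY (n + 1)))
      (tau^[2 * n + 1] (deltaBody (ofLam (Lam.boehmY (n + 1))))) := by
  induction n with
  | zero => exact .single (.beta _ _)
  | succ n ih =>
    rw [Lam.boehmY_succ_succ, ofLam]
    refine (ih.appL _).trans ?_
    refine (red_app_iterate_tau _ _ _).trans ?_
    rw [show 2 * (n + 1) + 1 = (2 * n + 1) + 2 by omega, Function.iterate_add_apply _ (2 * n + 1)]
    refine Red.iterate_tau ?_ _
    -- The two contractions per `δ`: first `δ` is passed to the abstraction, then the resulting head
    -- `δ` consumes its first argument.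
    exact .head (step_deltaBody _ _) (.single (.tau (.beta _ _)))

theorem boehmY_app_red (n : ℕ) (N : Clk) :
    Red (app (ofLam (Lam.boehmY (n + 1))) N)
      (tau^[2 * (n + 1)] (app N (app (ofLam (Lam.boehmY (n + 1))) N))) := by
  refine ((boehmY_red n).appL N).trans ((red_app_iterate_tau _ _ _).trans ?_)
  rw [show 2 * (n + 1) = (2 * n + 1) + 1 by omega, Function.iterate_add_apply _ (2 * n + 1)]
  exact Red.iterate_tau (.single (step_deltaBody _ _)) _

end Clk

theorem isClockedLevyTree_boehmY_succ (n x : ℕ) :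
    IsClockedLevyTree (.app (Lam.boehmY (n + 1)) (.var x)) (Tree.periodic (2 * (n + 1)) x) :=
  ⟨infRed_of_periodic (Clk.boehmY_app_red n (.var x)) (Tree.periodic_eq _ _),
    Tree.isNormal_of_periodic (Tree.periodic_eq _ _)⟩

theorem isClockedLevyTree_boehmY_zero (x : ℕ) :
    IsClockedLevyTree (.app (Lam.boehmY 0) (.var x)) (.tau (Tree.periodic 1 x)) := by
  refine ⟨.fold (.single (.beta _ _)) (.tau (infRed_of_periodic (c := 1) (x := x) ?_
    (Tree.periodic_eq 1 x))), (Tree.isNormal_of_periodic (Tree.periodic_eq _ _)).tau⟩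
  exact .single (.beta _ _)

/-! ### Trees up to finitely many symbols `τ` -/

namespace Tree

/-- The subtree reached by one step along the rightmost branch. -/
def next (T : Tree) : Tree :=
  match T.dest with
  | ⟨.var _, _⟩ => T
  | ⟨.lam, f⟩ => f (0 : Fin 1)
  | ⟨.app, f⟩ => f (1 : Fin 2)
  | ⟨.tau, f⟩ => f (0 : Fin 1)

theorem next_app (T U : Tree) : next (app T U) = U := rfl
theorem next_tau (T : Tree) : next (tau T) = T := rfl

/-- The rightmost branches of two trees have, from some point on, applications at the same
positions. -/
def SameTail (T U : Tree) : Prop :=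
  ∃ i j, ∀ k, (next^[k + i] T).dest.1 = Node.app ↔ (next^[k + j] U).dest.1 = Node.app

theorem SameTail.of_next {T U : Tree} (h : SameTail (next T) (next U)) : SameTail T U := by
  obtain ⟨i, j, h⟩ := h
  exact ⟨i + 1, j + 1, h⟩

theorem SameTail.refl (T : Tree) : SameTail T T := ⟨0, 0, fun _ => Iff.rfl⟩

theorem SameTail.trans {T U V : Tree} (h : SameTail T U) (h' : SameTail U V) :
    SameTail T V := by
  obtain ⟨i, j, h⟩ := h
  obtain ⟨i', j', h'⟩ := h'
  refine ⟨i' + i, j + j', fun k => ?_⟩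
  rw [← add_assoc, h, add_right_comm, h', add_assoc]

/-- Deleting a `τ` at the root shifts the rightmost branch by one, a step inside a left subterm does
not touch it, and the remaining cases recurse one place further along. -/
theorem TauStep.sameTail {T U : Tree} (h : TauStep T U) : SameTail T U := by
  induction h with
  | root T => exact ⟨1, 0, fun _ => Iff.rfl⟩
  | lam _ ih => exact .of_next ih
  | appL U _ _ => exact .of_next (.refl U)
  | appR T _ ih => exact .of_next ih
  | tau _ ih => exact .of_next ih

theorem TauEq.sameTail {T U : Tree} (h : TauEq T U) : SameTail T U := by
  induction h with
  | rel _ _ h => exact h.sameTail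
  | refl T => exact .refl T
  | symm _ _ _ ih =>
    obtain ⟨i, j, h⟩ := ih
    exact ⟨j, i, fun k => (h k).symm⟩
  | trans _ _ _ _ _ ih ih' => exact ih.trans ih'

theorem next_iterate_tau (T : Tree) (k : ℕ) : next^[k] (tau^[k] T) = T := by
  induction k with
  | zero => rfl
  | succ k ih => rw [Function.iterate_succ_apply' tau, Function.iterate_succ_apply, next_tau, ih]

theorem next_iterate_period {c x : ℕ} {S : Tree} (hS : S = tau^[c] (app (var x) S)) :
    next^[c + 1] S = S := by
  conv_lhs => rw [hS]
  rw [Function.iterate_succ_apply', next_iterate_tau, next_app]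

/-- One period of the rightmost branch consists of `c` symbols `τ` followed by one application, at
offset `c`. -/
theorem root_next_iterate {c x : ℕ} {S : Tree} (hS : S = tau^[c] (app (var x) S)) (k : ℕ) :
    (next^[k] S).dest.1 = Node.app ↔ k % (c + 1) = c := by
  have hper : next^[k] S = next^[k % (c + 1)] S := by
    conv_lhs => rw [← Nat.mod_add_div k (c + 1)]
    rw [Function.iterate_add_apply, Function.iterate_mul,
      Function.iterate_fixed (next_iterate_period hS)]
  have hlt := Nat.mod_lt k (Nat.succ_pos c)
  rw [hper]
  generalize k % (c + 1) = r at hlt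
  obtain ⟨d, rfl⟩ : ∃ d, c = r + d := ⟨c - r, by omega⟩
  rw [hS, Function.iterate_add_apply, next_iterate_tau]
  cases d with
  | zero => exact ⟨fun _ => rfl, fun _ => rfl⟩
  | succ d =>
    rw [Function.iterate_succ_apply']
    exact ⟨fun h => (nomatch h), fun h => by omega⟩

theorem SameTail.period_dvd {c d x y : ℕ} {S S' : Tree} (hS : S = tau^[c] (app (var x) S))
    (hS' : S' = tau^[d] (app (var y) S')) (h : SameTail S S') : d + 1 ∣ c + 1 := by
  obtain ⟨i, j, h⟩ := h
  simp only [root_next_iterate hS, root_next_iterate hS'] at h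
  -- This `k` makes `k + i` congruent to `c` modulo `c + 1`, an application of `S`. The next one, `c
  -- + 1` places later, must also match an application of `S'`, so `d + 1` divides the distance.
  obtain ⟨k, hk⟩ : ∃ k, k + i = c + (c + 1) * i := ⟨c + c * i, by ring⟩
  have h₁ := (h k).1 (by rw [hk, Nat.add_mul_mod_self_left, Nat.mod_eq_of_lt (by omega)])
  have h₂ := (h (k + (c + 1))).1 (by
    rw [add_right_comm, Nat.add_mod_right, hk, Nat.add_mul_mod_self_left,
      Nat.mod_eq_of_lt (by omega)])
  have : (k + j) % (d + 1) = (k + j + (c + 1)) % (d + 1) := by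
    rw [h₁, add_right_comm, h₂]
  simpa using (Nat.modEq_iff_dvd' (Nat.le_add_right _ _)).1 this

theorem TauEq.period_eq {c d x y : ℕ} {S S' : Tree} (hS : S = tau^[c] (app (var x) S))
    (hS' : S' = tau^[d] (app (var y) S')) (h : TauEq S S') : c = d :=
  Nat.succ_injective (Nat.dvd_antisymm (TauEq.sameTail (.symm _ _ h) |>.period_dvd hS' hS)
    (h.sameTail.period_dvd hS hS'))

end Tree

/-- The number of symbols `τ` in a period of the clocked Levy tree of `Yₙ x`. -/
def boehmPeriod (n : ℕ) : ℕ := if n = 0 then 1 else 2 * n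

/-- The value at `0` is odd, all others are even. -/
theorem boehmPeriod_injective : Function.Injective boehmPeriod := by
  intro m n h
  simp only [boehmPeriod] at h
  split_ifs at h <;> omega

/-- For `Y₀ x` the single `τ` in front lies outside the period and is removed by one step. -/
theorem IsClockedLevyTree.tauEq_periodic {n x : ℕ} {T : Tree}
    (h : IsClockedLevyTree (.app (Lam.boehmY n) (.var x)) T) :
    Tree.TauEq T (Tree.periodic (boehmPeriod n) x) := by
  cases n with
  | zero =>
    rw [h.unique (isClockedLevyTree_boehmY_zero x)]
    exact .rel _ _ (.root _)
  | succ n =>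
    rw [h.unique (isClockedLevyTree_boehmY_succ n x)]
    exact .refl _

theorem not_eventuallyMatches_boehmY {m n : ℕ} (hmn : m ≠ n) (x : ℕ) :
    ¬ EventuallyMatches (.app (Lam.boehmY m) (.var x)) (.app (Lam.boehmY n) (.var x)) := by
  rintro ⟨T, U, hT, hU, h⟩
  have h' : Tree.TauEq (Tree.periodic (boehmPeriod m) x) (Tree.periodic (boehmPeriod n) x) :=
    .trans _ _ _ (.symm _ _ hT.tauEq_periodic) (.trans _ _ _ h hU.tauEq_periodic)
  exact hmn (boehmPeriod_injective
    (h'.period_eq (Tree.periodic_eq _ x) (Tree.periodic_eq _ x)))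

end Clocked
theorem mainTheorem6 :
    -- the members of the sequence are fixed point combinators
    (∀ n : ℕ, Clocked.Lam.IsFixedPointCombinator (Clocked.Lam.boehmY n)) ∧
    -- they are pairwise inconvertible
    (∀ m n : ℕ, m ≠ n →
      ¬ Clocked.Lam.Conv (Clocked.Lam.boehmY m) (Clocked.Lam.boehmY n)) ∧
    -- they are simple terms, also when applied to a variable
    (∀ n : ℕ, Clocked.Lam.Simple (Clocked.Lam.boehmY n) ∧
      ∀ x : ℕ, Clocked.Lam.Simple (.app (Clocked.Lam.boehmY n) (.var x))) ∧
    -- the clocked Levy tree of `Y₀ x` is `τ(S)` with `S = τ(x S)`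
    (∀ x : ℕ, ∃ S : Clocked.Tree,
      S = Clocked.Tree.tau (Clocked.Tree.app (Clocked.Tree.var x) S) ∧
      ∀ T : Clocked.Tree,
        Clocked.IsClockedLevyTree (.app (Clocked.Lam.boehmY 0) (.var x)) T ↔
          T = Clocked.Tree.tau S) ∧
    -- the clocked Levy tree `S` of `Yₙ x`, for `n ≥ 1`, satisfies `S = τ²ⁿ(x S)`
    (∀ n : ℕ, 1 ≤ n → ∀ x : ℕ, ∃ S : Clocked.Tree,
      S = Clocked.Tree.tau^[2 * n] (Clocked.Tree.app (Clocked.Tree.var x) S) ∧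
      ∀ T : Clocked.Tree,
        Clocked.IsClockedLevyTree (.app (Clocked.Lam.boehmY n) (.var x)) T ↔ T = S) ∧
    -- these trees differ pairwise in infinitely many symbols `τ`
    (∀ m n : ℕ, m ≠ n → ∀ x : ℕ,
      ¬ Clocked.EventuallyMatches (.app (Clocked.Lam.boehmY m) (.var x))
        (.app (Clocked.Lam.boehmY n) (.var x))) := by
  open Clocked in
  refine ⟨Lam.isFixedPointCombinator_boehmY, fun m n => Lam.boehmY_not_conv,
    fun n => ⟨(Lam.BoehmSubterm.boehmY n).simple, fun x => (Lam.BoehmSubterm.boehmYApp n x).simple⟩,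
    fun x => ⟨Tree.periodic 1 x, Tree.periodic_eq 1 x, fun T => ⟨fun h => ?_, ?_⟩⟩,
    fun n hn x => ⟨Tree.periodic (2 * n) x, Tree.periodic_eq _ x, fun T => ?_⟩,
    fun m n => not_eventuallyMatches_boehmY⟩
  · exact h.unique (isClockedLevyTree_boehmY_zero x)
  · rintro rfl
    exact isClockedLevyTree_boehmY_zero x
  · obtain ⟨n, rfl⟩ : ∃ k, n = k + 1 := ⟨n - 1, by omega⟩
    refine ⟨fun h => h.unique (isClockedLevyTree_boehmY_succ n x), ?_⟩
    rintro rfl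
    exact isClockedLevyTree_boehmY_succ n x
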